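/- Let $a\ge 2/3$ and let $\varphi:\mathbb{R}^3\to\mathbb{R}^3$ be the vector field of the Lanford system $$\dot x=(a-1)x-y+xz,\qquad \dot y=x+(a-1)y+yz,\qquad \dot z=az-(x^2+y^2+z^2).$$ Let $K\subset\mathbb{R}^3$ be a compact set that is forward-invariant, i.e. for every point of $K$ the solution starting there exists for all $t\ge 0$ and stays in $K$. Let $\varphi^\tau$ denote the time-$\tau$ map of the system, let $B_\delta(p)$ be the open Euclidean ball of radius $\delta$ about $p$, and let $N_{\varphi,K}(\tau,p,\delta)$ be the minimal number of open $\delta$-balls (with arbitrary centres in $\mathbb{R}^3$) needed to cover $\varphi^\tau[B_\delta(p)\cap K]$. Then the limit defining the restoration entropy $$H_{\mathrm{res}}(\varphi,K):=\lim_{\tau\to\infty}\frac1\tau\,\limsup_{\delta\to 0+}\ \sup_{p\in K}\log_2 N_{\varphi,K}(\tau,p,\delta)$$ exists, and $$H_{\mathrm{res}}(\varphi,K)\le\frac{2(2a-1)}{\ln 2}.$$ (For $K=\varnothing$ the supremum is $-\infty$, and so is $H_{\mathrm{res}}$.) -/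

import Mathlib

open Set Filter Topology

noncomputable section

/-- The vector field of the Lanford system on `ℝ³`, with coordinates `x = p 0`, `y = p 1`,
`z = p 2`. -/
def lanfordField (a : ℝ) (p : EuclideanSpace ℝ (Fin 3)) : EuclideanSpace ℝ (Fin 3) :=
  !₂[(a - 1) * p 0 - p 1 + p 0 * p 2,
    p 0 + (a - 1) * p 1 + p 1 * p 2,
    a * p 2 - (p 0 ^ 2 + p 1 ^ 2 + p 2 ^ 2)]

/-- The image `φ^τ[S]` of a set `S` under the time-`τ` map of `ẋ = f(x)`: the set of end points
`γ τ` of the solutions `γ` on `[0, τ]` that start in `S`. -/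
def flowImage {E : Type*} [NormedAddCommGroup E] [NormedSpace ℝ E] (f : E → E) (τ : ℝ)
    (S : Set E) : Set E :=
  {y | ∃ γ : ℝ → E, IsIntegralCurveOn γ (fun _ => f) (Icc 0 τ) ∧ γ 0 ∈ S ∧ γ τ = y}

/-- `K` is forward-invariant for `ẋ = f(x)`: from every point of `K` there starts a solution
on `[0, ∞)`, and `φ^τ[K] ⊆ K` for all `τ ≥ 0`. -/
def IsForwardInvariantSet {E : Type*} [NormedAddCommGroup E] [NormedSpace ℝ E] (f : E → E)
    (K : Set E) : Prop :=
  (∀ x ∈ K, ∃ γ : ℝ → E, IsIntegralCurveOn γ (fun _ => f) (Ici 0) ∧ γ 0 = x) ∧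
    ∀ τ : ℝ, 0 ≤ τ → flowImage f τ K ⊆ K

/-- The minimal number of open `δ`-balls (with arbitrary centres) needed to cover `S`. -/
def ballCoveringNumber {E : Type*} [PseudoMetricSpace E] (δ : ℝ) (S : Set E) : ℕ∞ :=
  ⨅ (C : Set E) (_ : S ⊆ ⋃ c ∈ C, Metric.ball c δ), C.encard

/-- The quantity `limsup_{δ → 0+} sup_{a ∈ K} log₂ N(τ, a, δ)`, where `N(τ, a, δ)` is the minimal
number of open `δ`-balls needed to cover `φ^τ[B_δ(a) ∩ K]`. -/
def restorationBits {E : Type*} [NormedAddCommGroup E] [NormedSpace ℝ E] (f : E → E)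
    (K : Set E) (τ : ℝ) : EReal :=
  limsup (fun δ : ℝ => ⨆ a ∈ K,
    ENNReal.log ((ballCoveringNumber δ (flowImage f τ (Metric.ball a δ ∩ K)) : ℕ∞) : ENNReal) /
      ((Real.log 2 : ℝ) : EReal)) (𝓝[>] 0)

/-- The restoration entropy `H_res(f, K) = lim_{τ → ∞} (1/τ) limsup_{δ → 0+} sup_{a ∈ K}
log₂ N(τ, a, δ)` of `ẋ = f(x)` on `K`, in bits per unit time. -/
def restorationEntropy {E : Type*} [NormedAddCommGroup E] [NormedSpace ℝ E] (f : E → E)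
    (K : Set E) : EReal :=
  limUnder atTop (fun τ : ℝ => restorationBits f K τ / (τ : EReal))

end

/-!
The limit exists by Fekete's lemma.  Since the centres of the covering balls need not lie in `K`,
the quantity `restorationBits` need not be subadditive in `τ`; but in a proper space the trace on `K` of
a `δ`-ball is covered by a fixed number `m` of `δ`-balls centred in `K`
(`exists_card_cover_ball_inter`), so it is subadditive up to an additive
constant (`HasFlowCovers.add`), which is enough (`exists_tendsto_div_of_add_le`).  The same
argument shows that the entropy is at most `A` as soon as `2 ^ (A * τ + B)` balls always suffice
(`tendsto_restorationEntropy_and_le`).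

For the upper bound, the time-`τ` map sends a small ball about `p ∈ K`, up to an error quadratic in
the radius (`exists_norm_sub_sub_le_mul_sq`), to the ellipsoid `Y (B_δ)` where `Y` is the solution
operator of the linearized equation along the trajectory of `p`.  Covering this ellipsoid takes
`O(∏ max(1, σ i))` balls, where `σ 0, σ 1, σ 2` are the singular values of `Y`
(`exists_cover_ellipsoid`), so it remains to bound all partial products of singular values, that
is, the growth of lengths, areas and volumes under the linearized flow.

These are controlled by Lyapunov-type inequalities.  In the constant metric `dx² + dy² + dz² / 2`
the symmetric part of the Jacobian of the Lanford field is *diagonal*, with entries `a - 1 + z`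
(twice) and `a - 2 * z`.  With the weight `v = (4 / a) * z` one has
`v̇ = 4 * z - (4 / a) * (x² + y² + z²)`, and twice any sum of distinct diagonal entries is at most
`8 * a - 4 - v̇` (`lanford_rate_bounds`).  The sharp case is twice the double entry, where the
inequality reads `0 ≤ (4 / a) * ((z - a)² + x² + y²)`.  As `v` is bounded on `K`, it contributes
only a constant factor after integration, so squares of lengths, areas and volumes grow at most
like `exp ((8 * a - 4) * τ)`; the case of areas uses that the cross product of two solutions
satisfies a linear equation with the dual metric.
-/

/-! ### Images of the flow and their covers -/

section FlowImage

variable {E : Type*} [NormedAddCommGroup E] [NormedSpace ℝ E]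

lemma flowImage_mono (f : E → E) (τ : ℝ) {S T : Set E} (h : S ⊆ T) :
    flowImage f τ S ⊆ flowImage f τ T := by
  rintro y ⟨γ, hγ, h0, rfl⟩
  exact ⟨γ, hγ, h h0, rfl⟩

/-- The time-`(s + t)` image is contained in the time-`t` image of the time-`s` image. -/
lemma flowImage_add_subset (f : E → E) {s t : ℝ} (hs : 0 ≤ s) (ht : 0 ≤ t) (S : Set E) :
    flowImage f (s + t) S ⊆ flowImage f t (flowImage f s S) := by
  rintro y ⟨γ, hγ, h0, rfl⟩
  refine ⟨fun r => γ (r + s), ?_, ⟨γ, hγ.mono (Icc_subset_Icc_right (by linarith)), h0, by simp⟩,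
    by simp [add_comm]⟩
  intro r hr
  have h1 := hγ (r + s) ⟨by linarith [hr.1], by linarith [hr.2]⟩
  have h2 : HasDerivWithinAt (fun r : ℝ => r + s) 1 (Icc 0 t) r :=
    (hasDerivWithinAt_id r _).add_const s
  have hmaps : MapsTo (fun r : ℝ => r + s) (Icc 0 t) (Icc 0 (s + t)) := fun x hx =>
    ⟨by linarith [hx.1], by linarith [hx.2]⟩
  simpa [Function.comp_def] using HasDerivWithinAt.scomp r h1 h2 hmaps

lemma IsForwardInvariantSet.mem {f : E → E} {K : Set E} (hK : IsForwardInvariantSet f K)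
    {γ : ℝ → E} {τ : ℝ} (hγ : IsIntegralCurveOn γ (fun _ => f) (Icc 0 τ)) (h0 : γ 0 ∈ K)
    {t : ℝ} (ht : t ∈ Icc 0 τ) : γ t ∈ K :=
  hK.2 t ht.1 ⟨γ, hγ.mono (Icc_subset_Icc_right ht.2), h0, rfl⟩

lemma IsForwardInvariantSet.nonempty_flowImage {f : E → E} {K : Set E}
    (hK : IsForwardInvariantSet f K) {S : Set E} {x : E} (hxK : x ∈ K) (hxS : x ∈ S) (τ : ℝ) :
    (flowImage f τ S).Nonempty := by
  obtain ⟨γ, hγ, h0⟩ := hK.1 x hxK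
  exact ⟨γ τ, γ, hγ.mono Icc_subset_Ici_self, h0 ▸ hxS, rfl⟩

/-- Every image `φ^τ[B_δ(p) ∩ K]`, `p ∈ K`, is covered by at most `X` open `δ`-balls. -/
def HasFlowCovers (f : E → E) (K : Set E) (δ τ X : ℝ) : Prop :=
  ∀ p ∈ K, ∃ C : Finset E, (C.card : ℝ) ≤ X ∧
    flowImage f τ (Metric.ball p δ ∩ K) ⊆ ⋃ c ∈ C, Metric.ball c δ

lemma HasFlowCovers.mono {f : E → E} {K : Set E} {δ τ X Y : ℝ} (h : HasFlowCovers f K δ τ X)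
    (hXY : X ≤ Y) : HasFlowCovers f K δ τ Y := fun p hp =>
  let ⟨C, hC, hsub⟩ := h p hp
  ⟨C, hC.trans hXY, hsub⟩

end FlowImage

/-! ### Covering numbers and subadditivity -/

section Covering

lemma ballCoveringNumber_le_ofReal_iff {E : Type*} [PseudoMetricSpace E] {δ X : ℝ} (hX : 0 ≤ X)
    (S : Set E) :
    ((ballCoveringNumber δ S : ℕ∞) : ENNReal) ≤ ENNReal.ofReal X ↔
      ∃ C : Finset E, (C.card : ℝ) ≤ X ∧ S ⊆ ⋃ c ∈ C, Metric.ball c δ := by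
  constructor
  · intro h
    have hfin : ballCoveringNumber δ S ≠ ⊤ := by
      intro h'
      rw [h'] at h
      simp at h
    obtain ⟨n, hn⟩ := ENat.ne_top_iff_exists.1 hfin
    have hlt : ballCoveringNumber δ S < (n + 1 : ℕ) := by
      rw [← hn]; exact_mod_cast Nat.lt_succ_self n
    obtain ⟨C, hC⟩ := iInf_lt_iff.1 hlt
    obtain ⟨hsub, hcard⟩ := iInf_lt_iff.1 hC
    have hCf : C.Finite := by
      rw [← Set.encard_ne_top_iff]
      exact hcard.ne_top
    lift C to Finset E using hCf
    refine ⟨C, ?_, by simpa using hsub⟩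
    rw [Set.encard_coe_eq_coe_finsetCard] at hcard
    have hc : C.card ≤ n := Nat.lt_succ_iff.1 (by exact_mod_cast hcard)
    rw [← hn] at h
    have h2 : (n : ℝ) ≤ X := by
      have : ((n : ℕ) : ENNReal) ≤ ENNReal.ofReal X := by simpa using h
      rw [← ENNReal.ofReal_natCast] at this
      exact (ENNReal.ofReal_le_ofReal_iff hX).1 this
    exact le_trans (by exact_mod_cast hc) h2
  · rintro ⟨C, hC, hsub⟩
    have h1 : ballCoveringNumber δ S ≤ (C.card : ℕ∞) := by
      refine iInf₂_le_of_le (C : Set E) (by simpa using hsub) ?_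
      rw [Set.encard_coe_eq_coe_finsetCard]
    calc ((ballCoveringNumber δ S : ℕ∞) : ENNReal) ≤ ((C.card : ℕ∞) : ENNReal) := by
          exact_mod_cast h1
      _ = ENNReal.ofReal (C.card : ℝ) := by simp
      _ ≤ _ := ENNReal.ofReal_le_ofReal hC

variable {E : Type*} [NormedAddCommGroup E] [NormedSpace ℝ E]

lemma iSup_log_ballCoveringNumber_le_iff (f : E → E) (K : Set E) (δ τ x : ℝ) :
    (⨆ a ∈ K, ENNReal.log ((ballCoveringNumber δ (flowImage f τ (Metric.ball a δ ∩ K)) : ℕ∞) :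
      ENNReal) / ((Real.log 2 : ℝ) : EReal)) ≤ (x : EReal) ↔
      HasFlowCovers f K δ τ ((2 : ℝ) ^ x) := by
  rw [iSup₂_le_iff]
  refine forall₂_congr fun p _ => ?_
  have hl : (0 : ℝ) < Real.log 2 := Real.log_pos (by norm_num)
  rw [← ballCoveringNumber_le_ofReal_iff (by positivity),
    EReal.div_le_iff_le_mul (by exact_mod_cast hl) (EReal.coe_ne_top _), ← EReal.coe_mul,
    ← ENNReal.log_le_log_iff, ENNReal.log_ofReal_of_pos (by positivity),
    Real.log_rpow (by norm_num), mul_comm]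

lemma restorationBits_le {f : E → E} {K : Set E} {τ x : ℝ}
    (h : ∀ᶠ δ in 𝓝[>] (0 : ℝ), HasFlowCovers f K δ τ ((2 : ℝ) ^ x)) :
    restorationBits f K τ ≤ (x : EReal) := by
  refine limsup_le_of_le (h := ?_)
  filter_upwards [h] with δ hδ
  exact (iSup_log_ballCoveringNumber_le_iff f K δ τ x).2 hδ

lemma eventually_hasFlowCovers_of_restorationBits_lt {f : E → E} {K : Set E} {τ x : ℝ}
    (h : restorationBits f K τ < (x : EReal)) :
    ∀ᶠ δ in 𝓝[>] (0 : ℝ), HasFlowCovers f K δ τ ((2 : ℝ) ^ x) := by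
  filter_upwards [eventually_lt_of_limsup_lt h] with δ hδ
  exact (iSup_log_ballCoveringNumber_le_iff f K δ τ x).1 hδ.le

lemma restorationBits_nonneg {f : E → E} {K : Set E} (hK : IsForwardInvariantSet f K)
    (hne : K.Nonempty) (τ : ℝ) : 0 ≤ restorationBits f K τ := by
  by_contra! hlt
  obtain ⟨x, hx1, hx2⟩ := EReal.lt_iff_exists_real_btwn.1 hlt
  obtain ⟨δ, hcov, hδ⟩ := ((eventually_hasFlowCovers_of_restorationBits_lt hx1).and
    self_mem_nhdsWithin).exists
  obtain ⟨p, hp⟩ := hne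
  obtain ⟨C, hC, hsub⟩ := hcov p hp
  obtain ⟨y, hy⟩ := hK.nonempty_flowImage (S := Metric.ball p δ ∩ K) hp
    ⟨Metric.mem_ball_self hδ, hp⟩ τ
  have hcard : 1 ≤ C.card := by
    obtain ⟨c, hc, -⟩ := mem_iUnion₂.1 (hsub hy)
    exact Finset.card_pos.2 ⟨c, hc⟩
  have h2 : (2 : ℝ) ^ x < 1 :=
    Real.rpow_lt_one_of_one_lt_of_neg (by norm_num) (by exact_mod_cast hx2)
  have : (1 : ℝ) ≤ C.card := by exact_mod_cast hcard
  linarith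

/-- In a proper space every trace `B_δ(c) ∩ K` is covered by a number of `δ`-balls *centred in*
`K` that depends neither on `δ` nor on `c` and `K`. -/
lemma exists_card_cover_ball_inter (E : Type*) [NormedAddCommGroup E] [NormedSpace ℝ E]
    [ProperSpace E] :
    ∃ m : ℕ, ∀ (K : Set E) (c : E) (δ : ℝ), 0 < δ → ∃ D : Finset E, D.card ≤ m ∧
      (D : Set E) ⊆ K ∧ Metric.ball c δ ∩ K ⊆ ⋃ d ∈ D, Metric.ball d δ := by
  classical
  obtain ⟨T, -, hTf, hT⟩ := (isCompact_closedBall (0 : E) 1).finite_cover_balls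
    (e := 1 / 2) (by norm_num)
  lift T to Finset E using hTf
  refine ⟨T.card, fun K c δ hδ => ?_⟩
  let U := T.filter fun u => (Metric.ball (c + δ • u) (δ / 2) ∩ K).Nonempty
  choose! q hq using fun u (hu : (Metric.ball (c + δ • u) (δ / 2) ∩ K).Nonempty) => hu
  refine ⟨U.image q, Finset.card_image_le.trans (Finset.card_filter_le _ _), ?_, ?_⟩
  · intro y hy
    obtain ⟨u, hu, rfl⟩ := Finset.mem_image.1 (Finset.mem_coe.1 hy)
    exact (hq u (Finset.mem_filter.1 hu).2).2
  · rintro x ⟨hx, hxK⟩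
    have h1 : δ⁻¹ • (x - c) ∈ Metric.closedBall (0 : E) 1 := by
      rw [mem_closedBall_zero_iff, norm_smul, Real.norm_of_nonneg (by positivity)]
      rw [Metric.mem_ball, dist_eq_norm] at hx
      rw [inv_mul_le_iff₀ hδ]; linarith
    obtain ⟨u, hu, hxu⟩ := mem_iUnion₂.1 (hT h1)
    have h2 : x ∈ Metric.ball (c + δ • u) (δ / 2) := by
      rw [Metric.mem_ball, dist_eq_norm] at hxu ⊢
      have : x - (c + δ • u) = δ • (δ⁻¹ • (x - c) - u) := by
        rw [smul_sub, smul_inv_smul₀ hδ.ne']; abel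
      rw [this, norm_smul, Real.norm_of_nonneg hδ.le]
      nlinarith
    have hne : (Metric.ball (c + δ • u) (δ / 2) ∩ K).Nonempty := ⟨x, h2, hxK⟩
    refine mem_iUnion₂.2 ⟨q u, Finset.mem_image_of_mem _ (Finset.mem_filter.2 ⟨hu, hne⟩), ?_⟩
    have h3 := (hq u hne).1
    rw [Metric.mem_ball] at h2 h3 ⊢
    linarith [dist_triangle_right x (q u) (c + δ • u)]

/-- Covers of time-`s` and time-`t` images combine to covers of time-`(s + t)` images.  The
constant `m` pays for moving the centres of the first cover into `K`. -/
lemma HasFlowCovers.add [ProperSpace E] {f : E → E} {K : Set E} (hK : IsForwardInvariantSet f K)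
    {m : ℕ} (hm : ∀ (K : Set E) (c : E) (δ : ℝ), 0 < δ → ∃ D : Finset E, D.card ≤ m ∧
      (D : Set E) ⊆ K ∧ Metric.ball c δ ∩ K ⊆ ⋃ d ∈ D, Metric.ball d δ)
    {s t δ X Y : ℝ} (hs : 0 ≤ s) (ht : 0 ≤ t) (hδ : 0 < δ) (hY : 0 ≤ Y)
    (h1 : HasFlowCovers f K δ s X) (h2 : HasFlowCovers f K δ t Y) :
    HasFlowCovers f K δ (s + t) (X * m * Y) := by
  classical
  intro p hp
  obtain ⟨C, hC, hsub⟩ := h1 p hp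
  choose D hDm hDK hD using fun c => hm K c δ hδ
  choose! G hG hGsub using h2
  refine ⟨C.biUnion fun c => (D c).biUnion G, ?_, ?_⟩
  · have hb : ∀ c, (((D c).biUnion G).card : ℝ) ≤ m * Y := fun c => by
      calc (((D c).biUnion G).card : ℝ) ≤ ∑ d ∈ D c, ((G d).card : ℝ) := by
            exact_mod_cast Finset.card_biUnion_le
        _ ≤ ∑ d ∈ D c, Y := Finset.sum_le_sum fun d hd => hG d (hDK c hd)
        _ = (D c).card * Y := by rw [Finset.sum_const, nsmul_eq_mul]
        _ ≤ m * Y := by gcongr; exact hDm c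
    calc ((C.biUnion fun c => (D c).biUnion G).card : ℝ)
        ≤ ∑ c ∈ C, (((D c).biUnion G).card : ℝ) := by exact_mod_cast Finset.card_biUnion_le
      _ ≤ ∑ c ∈ C, (m * Y : ℝ) := Finset.sum_le_sum fun c _ => hb c
      _ = C.card * (m * Y) := by rw [Finset.sum_const, nsmul_eq_mul]
      _ ≤ X * (m * Y) := by gcongr
      _ = X * m * Y := by ring
  · intro y hy
    obtain ⟨γ, hγ, h0, rfl⟩ := flowImage_add_subset f hs ht _ hy
    have hγK : γ 0 ∈ K := hK.2 s hs (flowImage_mono f s inter_subset_right h0)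
    obtain ⟨c, hc, hγc⟩ := mem_iUnion₂.1 (hsub h0)
    obtain ⟨d, hd, hγd⟩ := mem_iUnion₂.1 (hD c ⟨hγc, hγK⟩)
    obtain ⟨g, hg, hgy⟩ := mem_iUnion₂.1 (hGsub d (hDK c hd) ⟨γ, hγ, ⟨hγd, hγK⟩, rfl⟩)
    refine mem_iUnion₂.2 ⟨g, ?_, hgy⟩
    exact Finset.mem_biUnion.2 ⟨c, hc, Finset.mem_biUnion.2 ⟨d, hd, hg⟩⟩

end Covering

/-! ### Fekete's lemma in continuous time -/

section Fekete

/-- Fekete's lemma in continuous time, for a nonnegative function that is subadditive up to an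
additive constant and bounded by an affine function. -/
lemma exists_tendsto_div_of_add_le {g : ℝ → ℝ} {c A B : ℝ}
    (hadd : ∀ s t, 0 ≤ s → 0 ≤ t → g (s + t) ≤ g s + g t + c) (hnn : ∀ t, 0 ≤ g t)
    (hle : ∀ t, 0 ≤ t → g t ≤ A * t + B) :
    ∃ l, Tendsto (fun t => g t / t) atTop (𝓝 l) ∧ l ≤ A := by
  have hsub : Subadditive fun n : ℕ => g n + c := fun m n => by
    have := hadd m n m.cast_nonneg n.cast_nonneg
    push_cast
    linarith
  have hbdd : BddBelow (range fun n : ℕ => (g n + c) / n) := by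
    refine ⟨-|c|, ?_⟩
    rintro _ ⟨n, rfl⟩
    rcases Nat.eq_zero_or_pos n with rfl | hn
    · simp
    · have hn' : (1 : ℝ) ≤ n := by exact_mod_cast hn
      rw [le_div_iff₀ (by linarith)]
      nlinarith [hnn n, neg_abs_le c, abs_nonneg c]
  have hlim := hsub.tendsto_lim hbdd
  set l := hsub.lim
  have hfl := hlim.comp (tendsto_nat_floor_atTop (α := ℝ))
  have hfl1 := hlim.comp ((tendsto_add_atTop_nat 1).comp (tendsto_nat_floor_atTop (α := ℝ)))
  have hr : Tendsto (fun t : ℝ => (⌊t⌋₊ : ℝ) / t) atTop (𝓝 1) := tendsto_nat_floor_div_atTop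
  have hz : ∀ k : ℝ, Tendsto (fun t : ℝ => k / t) atTop (𝓝 0) := fun k =>
    tendsto_const_nhds.div_atTop tendsto_id
  -- `M` bounds `g` on the unit interval
  set M := |A| + B with hM
  have hg1 : ∀ r, 0 ≤ r → r ≤ 1 → g r ≤ M := fun r h0 h1 => by
    have := hle r h0
    nlinarith [le_abs_self A, abs_nonneg A]
  have hup : Tendsto (fun t : ℝ => (g ⌊t⌋₊ + c) / (⌊t⌋₊ : ℝ) * ((⌊t⌋₊ : ℝ) / t) + M / t) atTop
      (𝓝 l) := by
    simpa using (hfl.mul hr).add (hz M)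
  have hlo : Tendsto (fun t : ℝ => (g ((⌊t⌋₊ + 1 : ℕ) : ℝ) + c) / ((⌊t⌋₊ + 1 : ℕ) : ℝ) *
      ((⌊t⌋₊ : ℝ) / t + 1 / t) - (M + 2 * c) / t) atTop (𝓝 l) := by
    simpa using (hfl1.mul (hr.add (hz 1))).sub (hz (M + 2 * c))
  have htend : Tendsto (fun t => g t / t) atTop (𝓝 l) := by
    refine tendsto_of_tendsto_of_tendsto_of_le_of_le' hlo hup ?_ ?_
    · filter_upwards [eventually_ge_atTop 1] with t ht
      have hf1 := Nat.floor_le (show (0 : ℝ) ≤ t by linarith)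
      have hf2 := Nat.lt_floor_add_one t
      have h1 := hadd t ((⌊t⌋₊ + 1 : ℕ) - t) (by linarith) (by push_cast; linarith)
      have h2 := hg1 ((⌊t⌋₊ + 1 : ℕ) - t) (by push_cast; linarith) (by push_cast; linarith)
      rw [add_sub_cancel] at h1
      have hpos : (0 : ℝ) < ((⌊t⌋₊ + 1 : ℕ) : ℝ) := by positivity
      have ht0 : (0 : ℝ) < t := by linarith
      have e : (g ((⌊t⌋₊ + 1 : ℕ) : ℝ) + c) / ((⌊t⌋₊ + 1 : ℕ) : ℝ) *
          ((⌊t⌋₊ : ℝ) / t + 1 / t) - (M + 2 * c) / t =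
          (g ((⌊t⌋₊ + 1 : ℕ) : ℝ) + c - (M + 2 * c)) / t := by
        push_cast at hpos ⊢
        field_simp
      rw [e]
      gcongr
      linarith
    · filter_upwards [eventually_ge_atTop 1] with t ht
      have hf1 := Nat.floor_le (show (0 : ℝ) ≤ t by linarith)
      have hf2 := Nat.lt_floor_add_one t
      have h1 := hadd ⌊t⌋₊ (t - ⌊t⌋₊) (by positivity) (by linarith)
      have h2 := hg1 (t - ⌊t⌋₊) (by linarith) (by linarith)
      rw [add_sub_cancel] at h1
      have hpos : (0 : ℝ) < (⌊t⌋₊ : ℝ) := by exact_mod_cast Nat.floor_pos.2 ht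
      have ht0 : (0 : ℝ) < t := by linarith
      have e : (g ⌊t⌋₊ + c) / (⌊t⌋₊ : ℝ) * ((⌊t⌋₊ : ℝ) / t) + M / t = (g ⌊t⌋₊ + c + M) / t := by
        field_simp
      rw [e]
      gcongr
      linarith
  refine ⟨l, htend, le_of_tendsto_of_tendsto htend (b := atTop) (g := fun t => A + B / t)
    (by simpa using tendsto_const_nhds.add (hz B)) ?_⟩
  filter_upwards [eventually_gt_atTop 0] with t ht
  have := hle t ht.le
  have e : A + B / t = (A * t + B) / t := by field_simp
  rw [e]
  gcongr

end Fekete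

/-! ### Restoration entropy from covering bounds -/

section Entropy

variable {E : Type*} [NormedAddCommGroup E] [NormedSpace ℝ E] [ProperSpace E]

lemma exists_restorationBits_add_le {f : E → E} {K : Set E} (hK : IsForwardInvariantSet f K) :
    ∃ c : ℝ, ∀ s t x y : ℝ, 0 ≤ s → 0 ≤ t → restorationBits f K s < (x : EReal) →
      restorationBits f K t < (y : EReal) →
      restorationBits f K (s + t) ≤ ((x + y + c : ℝ) : EReal) := by
  obtain ⟨m, hm⟩ := exists_card_cover_ball_inter E
  -- `m + 1` instead of `m`, as the logarithm needs a positive argument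
  refine ⟨Real.logb 2 (m + 1), fun s t x y hs ht hx hy => restorationBits_le ?_⟩
  filter_upwards [eventually_hasFlowCovers_of_restorationBits_lt hx,
    eventually_hasFlowCovers_of_restorationBits_lt hy, self_mem_nhdsWithin] with δ h1 h2 hδ
  refine (HasFlowCovers.add hK hm hs ht hδ (by positivity) h1 h2).mono ?_
  rw [Real.rpow_add (by norm_num), Real.rpow_add (by norm_num),
    Real.rpow_logb (by norm_num) (by norm_num) (by positivity)]
  have : (0 : ℝ) < 2 ^ x * 2 ^ y := by positivity
  nlinarith

/-- If the time-`τ` images of small `δ`-balls are covered by `2 ^ (A * τ + B)` balls of the same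
radius, the limit defining the restoration entropy exists and is at most `A`. -/
theorem tendsto_restorationEntropy_and_le {f : E → E} {K : Set E}
    (hK : IsForwardInvariantSet f K) {A B : ℝ}
    (hcov : ∀ τ, 0 ≤ τ → ∀ᶠ δ in 𝓝[>] (0 : ℝ), HasFlowCovers f K δ τ ((2 : ℝ) ^ (A * τ + B))) :
    Tendsto (fun τ : ℝ => restorationBits f K τ / (τ : EReal)) atTop
        (𝓝 (restorationEntropy f K)) ∧
      restorationEntropy f K ≤ (A : EReal) := by
  suffices h : ∃ l : EReal, l ≤ A ∧
      Tendsto (fun τ : ℝ => restorationBits f K τ / (τ : EReal)) atTop (𝓝 l) by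
    obtain ⟨l, hl, ht⟩ := h
    have : restorationEntropy f K = l := ht.limUnder_eq
    rw [this]
    exact ⟨ht, hl⟩
  rcases K.eq_empty_or_nonempty with rfl | hne
  · refine ⟨⊥, bot_le, ?_⟩
    refine tendsto_const_nhds.congr' ?_
    filter_upwards [eventually_gt_atTop 0] with τ hτ
    have : restorationBits f (∅ : Set E) τ = ⊥ := by simp [restorationBits]
    rw [this, EReal.bot_div_of_pos_ne_top (by exact_mod_cast hτ) (EReal.coe_ne_top _)]
  · set g : ℝ → ℝ := fun τ => (restorationBits f K τ).toReal with hg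
    have hnn : ∀ τ, 0 ≤ g τ := fun τ => EReal.toReal_nonneg (restorationBits_nonneg hK hne τ)
    have hle : ∀ τ, 0 ≤ τ → restorationBits f K τ ≤ ((A * τ + B : ℝ) : EReal) := fun τ hτ =>
      restorationBits_le (hcov τ hτ)
    have hcoe : ∀ τ, 0 ≤ τ → restorationBits f K τ = (g τ : EReal) := fun τ hτ =>
      (EReal.coe_toReal ((hle τ hτ).trans_lt (EReal.coe_lt_top _)).ne
        (((EReal.bot_lt_zero).trans_le (restorationBits_nonneg hK hne τ)).ne')).symm
    obtain ⟨c, hc⟩ := exists_restorationBits_add_le hK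
    have hadd : ∀ s t, 0 ≤ s → 0 ≤ t → g (s + t) ≤ g s + g t + c := by
      intro s t hs ht
      refine le_of_forall_pos_le_add fun ε hε => ?_
      have := hc s t (g s + ε / 2) (g t + ε / 2) hs ht
        (by rw [hcoe s hs]; exact_mod_cast (by linarith))
        (by rw [hcoe t ht]; exact_mod_cast (by linarith))
      rw [hcoe _ (add_nonneg hs ht), EReal.coe_le_coe_iff] at this
      linarith
    have hle' : ∀ τ, 0 ≤ τ → g τ ≤ A * τ + B := fun τ hτ => by
      have := hle τ hτ
      rwa [hcoe τ hτ, EReal.coe_le_coe_iff] at this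
    obtain ⟨l, hl, hlA⟩ := exists_tendsto_div_of_add_le hadd hnn hle'
    refine ⟨l, by exact_mod_cast hlA, ?_⟩
    refine ((continuous_coe_real_ereal.tendsto l).comp hl).congr' ?_
    filter_upwards [eventually_ge_atTop 0] with τ hτ
    rw [hcoe τ hτ, ← EReal.coe_div]
    rfl

end Entropy

/-! ### Linear differential equations -/

section LinearODE

variable {E : Type*} [NormedAddCommGroup E] [NormedSpace ℝ E]

/-- Picard–Lindelöf for a linear equation on an interval of length at most `1 / (2 * M)`. -/
lemma exists_linear_ode_solution_short [CompleteSpace E] {A : ℝ → E →L[ℝ] E} {a b M : ℝ}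
    (hab : a ≤ b) (hA : ContinuousOn A (Icc a b)) (hM0 : 0 ≤ M) (hM : ∀ t ∈ Icc a b, ‖A t‖ ≤ M)
    (hlen : M * (b - a) ≤ 1 / 2) (x : E) :
    ∃ y : ℝ → E, y a = x ∧ ∀ t ∈ Icc a b, HasDerivWithinAt y (A t (y t)) (Icc a b) t := by
  have hPL : IsPicardLindelof (fun t y => A t y) (⟨a, left_mem_Icc.2 hab⟩ : Icc a b) x
      ‖x‖₊ 0 (2 * M.toNNReal * ‖x‖₊) M.toNNReal := by
    refine ⟨fun t ht => ?_, fun y _ => hA.clm_apply continuousOn_const, fun t ht y hy => ?_, ?_⟩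
    · refine LipschitzOnWith.of_dist_le_mul fun u _ v _ => ?_
      rw [dist_eq_norm, dist_eq_norm, ← map_sub, Real.coe_toNNReal _ hM0]
      exact (A t).le_of_opNorm_le (hM t ht) _
    · have hy' : ‖y‖ ≤ 2 * ‖x‖ := by
        have h1 : ‖y - x‖ ≤ ‖x‖ := by simpa [dist_eq_norm] using hy
        linarith [norm_le_norm_add_norm_sub' y x]
      calc ‖A t y‖ ≤ M * ‖y‖ := (A t).le_of_opNorm_le (hM t ht) _
        _ ≤ M * (2 * ‖x‖) := by gcongr
        _ = _ := by
          push_cast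
          rw [Real.coe_toNNReal _ hM0]; ring
    · push_cast
      rw [Real.coe_toNNReal _ hM0, max_eq_left (by simpa using hab)]
      have := norm_nonneg x
      simp only [sub_zero]
      nlinarith
  obtain ⟨y, hy0, hy⟩ := hPL.exists_eq_forall_mem_Icc_hasDerivWithinAt₀
  exact ⟨y, hy0, hy⟩

/-- A linear equation with continuous coefficients is solvable on every compact interval. -/
lemma exists_linear_ode_solution [CompleteSpace E] {A : ℝ → E →L[ℝ] E} {a b M : ℝ}
    (hab : a ≤ b) (hA : ContinuousOn A (Icc a b)) (hM : ∀ t ∈ Icc a b, ‖A t‖ ≤ M) (x : E) :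
    ∃ y : ℝ → E, y a = x ∧ ∀ t ∈ Icc a b, HasDerivWithinAt y (A t (y t)) (Icc a b) t := by
  have hM0 : 0 ≤ M := (norm_nonneg _).trans (hM a (left_mem_Icc.2 hab))
  -- Solve on intervals of length at most `1 / (2 * M)` and glue.
  obtain ⟨n, hn⟩ := exists_nat_ge (2 * (M * (b - a)))
  replace hn : M * (b - a) ≤ (n + 1) * (1 / 2) := by linarith
  induction n generalizing b with
  | zero => exact exists_linear_ode_solution_short hab hA hM0 hM (by simpa using hn) x
  | succ n ih =>
    set c := a + (b - a) * ((n + 1) / (n + 2)) with hc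
    have hac : a ≤ c := by
      have : 0 ≤ (b - a) * ((n + 1 : ℝ) / (n + 2)) := by
        have := sub_nonneg.2 hab
        positivity
      linarith
    have hbc : b - c = (b - a) / (n + 2) := by
      rw [hc]; field_simp; ring
    have hcb : c ≤ b := by
      have : 0 ≤ (b - a) / (n + 2 : ℝ) := by
        have := sub_nonneg.2 hab
        positivity
      linarith
    have hn' : M * (b - a) / (n + 2) ≤ 1 / 2 := by
      rw [div_le_iff₀ (by positivity)]
      push_cast at hn
      linarith
    obtain ⟨y, hy0, hy⟩ := ih hac (hA.mono (Icc_subset_Icc_right hcb))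
      (fun t ht => hM t (Icc_subset_Icc_right hcb ht)) (by
        have : M * (c - a) = (M * (b - a) / (n + 2)) * (n + 1) := by rw [hc]; field_simp; ring
        rw [this]
        have : (0 : ℝ) < n + 1 := by positivity
        nlinarith)
    obtain ⟨z, hz0, hz⟩ := exists_linear_ode_solution_short hcb
      (hA.mono (Icc_subset_Icc_left hac)) hM0 (fun t ht => hM t (Icc_subset_Icc_left hac ht))
      (by rw [hbc, ← mul_div_assoc]; exact hn') (y c)
    set w : ℝ → E := fun t => if t ≤ c then y t else z t with hw
    have hwy : EqOn w y (Icc a c) := fun t ht => if_pos ht.2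
    have hwz : EqOn w z (Icc c b) := fun t ht => by
      rcases ht.1.eq_or_lt with rfl | h
      · simp [hw, hz0]
      · exact if_neg h.not_ge
    refine ⟨w, by rw [hwy (left_mem_Icc.2 hac), hy0], fun t ht => ?_⟩
    rw [← Icc_union_Icc_eq_Icc hac hcb]
    have h1 : t ∈ Icc a c → HasDerivWithinAt w (A t (w t)) (Icc a c) t := fun h => by
      rw [hwy h]
      exact (hy t h).congr hwy (hwy h)
    have h2 : t ∈ Icc c b → HasDerivWithinAt w (A t (w t)) (Icc c b) t := fun h => by
      rw [hwz h]
      exact (hz t h).congr hwz (hwz h)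
    rcases lt_trichotomy t c with h | rfl | h
    · refine (h1 ⟨ht.1, h.le⟩).union (HasFDerivWithinAt.of_notMem_closure ?_)
      rw [closure_Icc]
      exact fun h' => h'.1.not_gt h
    · exact (h1 (right_mem_Icc.2 hac)).union (h2 (left_mem_Icc.2 hcb))
    · refine HasDerivWithinAt.union (HasFDerivWithinAt.of_notMem_closure ?_) (h2 ⟨h.le, ht.2⟩)
      rw [closure_Icc]
      exact fun h' => h'.2.not_gt h

/-- The solution operator of a linear equation: a linear map `Y` such that `Y u` is the end point
of a solution starting in `u`. -/
lemma exists_fundamental_solution [FiniteDimensional ℝ E] {A : ℝ → E →L[ℝ] E} {a b M : ℝ}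
    (hab : a ≤ b) (hA : ContinuousOn A (Icc a b)) (hM : ∀ t ∈ Icc a b, ‖A t‖ ≤ M) :
    ∃ Y : E →ₗ[ℝ] E, ∀ u, ∃ y : ℝ → E, y a = u ∧ y b = Y u ∧
      ∀ t ∈ Icc a b, HasDerivWithinAt y (A t (y t)) (Icc a b) t := by
  have : CompleteSpace E := FiniteDimensional.complete ℝ E
  let e := Module.finBasis ℝ E
  choose y hy0 hy using fun i => exists_linear_ode_solution hab hA hM (e i)
  refine ⟨e.constr ℝ fun i => y i b, fun u =>
    ⟨fun t => ∑ i, e.repr u i • y i t, ?_, ?_, fun t ht => ?_⟩⟩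
  · simp_rw [hy0]
    exact e.sum_repr u
  · simp [Module.Basis.constr_apply_fintype, Module.Basis.equivFun_apply]
  · have : A t (∑ i, e.repr u i • y i t) = ∑ i, e.repr u i • A t (y i t) := by simp
    rw [this]
    exact HasDerivWithinAt.fun_sum fun i _ => (hy i t ht).const_smul _

end LinearODE

/-! ### Grönwall's inequality with a weight -/

section Gronwall

/-- Grönwall's inequality with a time-dependent rate that differs from the constant `c` by the
derivative of a function `v`. -/
lemma le_mul_exp_of_hasDerivWithinAt_le {g g' v v' : ℝ → ℝ} {c τ : ℝ} (hτ : 0 ≤ τ)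
    (hg : ∀ t ∈ Icc 0 τ, HasDerivWithinAt g (g' t) (Icc 0 τ) t)
    (hv : ∀ t ∈ Icc 0 τ, HasDerivWithinAt v (v' t) (Icc 0 τ) t)
    (hle : ∀ t ∈ Icc 0 τ, g' t ≤ (c - v' t) * g t) :
    g τ ≤ g 0 * Real.exp (c * τ + (v 0 - v τ)) := by
  have hd : ∀ t ∈ Icc 0 τ, HasDerivWithinAt (fun t => g t * Real.exp (v t - c * t))
      (g' t * Real.exp (v t - c * t) + g t * (Real.exp (v t - c * t) * (v' t - c))) (Icc 0 τ) t := by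
    intro t ht
    have h1 : HasDerivWithinAt (fun t => v t - c * t) (v' t - c) (Icc 0 τ) t := by
      have := (hv t ht).fun_sub ((hasDerivWithinAt_id t (Icc 0 τ)).const_mul c)
      rwa [mul_one] at this
    exact (hg t ht).mul h1.exp
  have hanti : AntitoneOn (fun t => g t * Real.exp (v t - c * t)) (Icc 0 τ) := by
    refine antitoneOn_of_hasDerivWithinAt_nonpos (convex_Icc 0 τ)
      (f' := fun t => g' t * Real.exp (v t - c * t) + g t * (Real.exp (v t - c * t) * (v' t - c)))
      (fun t ht => (hd t ht).continuousWithinAt)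
      (fun t ht => (hd t (interior_subset ht)).mono interior_subset) fun t ht => ?_
    have h1 := hle t (interior_subset ht)
    have h2 := Real.exp_pos (v t - c * t)
    nlinarith
  have h := hanti (left_mem_Icc.2 hτ) (right_mem_Icc.2 hτ) hτ
  simp only [mul_zero, sub_zero] at h
  have e : Real.exp (c * τ + (v 0 - v τ)) = Real.exp (v 0) / Real.exp (v τ - c * τ) := by
    rw [← Real.exp_sub]; congr 1; ring
  rw [e, ← mul_div_assoc, le_div_iff₀ (Real.exp_pos _)]
  exact h

end Gronwall

/-! ### Covering ellipsoids -/

section Ellipsoid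

variable {E : Type*} [NormedAddCommGroup E] [InnerProductSpace ℝ E]

/-- A linear image of a `δ`-ball, thickened by `δ / 8`, is covered by few `δ`-balls, in terms of
the lengths `‖Y (u i)‖` of the images of an orthonormal basis.  The centres form a grid whose mesh
in direction `Y (u i)` is at most `δ / 4`. -/
lemma exists_cover_ellipsoid (u : OrthonormalBasis (Fin 3) ℝ E) (Y : E →ₗ[ℝ] E) (q : E) {δ : ℝ}
    (hδ : 0 < δ) :
    ∃ C : Finset E, (C.card : ℝ) ≤ 11 ^ 3 * ∏ i, max 1 ‖Y (u i)‖ ∧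
      ∀ v e : E, ‖v‖ < δ → ‖e‖ ≤ δ / 8 → q + Y v + e ∈ ⋃ c ∈ C, Metric.ball c δ := by
  classical
  set n : Fin 3 → ℕ := fun i => ⌈4 * max 1 ‖Y (u i)‖⌉₊ with hn
  have hn4 : ∀ i, 4 * max 1 ‖Y (u i)‖ ≤ n i := fun i => Nat.le_ceil _
  have hn1 : ∀ i, (n i : ℝ) ≤ 4 * max 1 ‖Y (u i)‖ + 1 := fun i =>
    (Nat.ceil_lt_add_one (by positivity)).le
  have hm : ∀ i, 1 ≤ max 1 ‖Y (u i)‖ := fun i => le_max_left _ _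
  have hn0 : ∀ i, (0 : ℝ) < n i := fun i => by linarith [hn4 i, hm i]
  refine ⟨(Fintype.piFinset fun i => Finset.Icc (-(n i : ℤ)) (n i)).image
    fun k => q + ∑ i, (k i * δ / n i : ℝ) • Y (u i), ?_, fun v e hv he => ?_⟩
  · calc _ ≤ ((Fintype.piFinset fun i => Finset.Icc (-(n i : ℤ)) (n i)).card : ℝ) := by
          exact_mod_cast Finset.card_image_le
      _ = ∏ i, (2 * (n i : ℝ) + 1) := by
          rw [Fintype.card_piFinset, Nat.cast_prod]
          refine Finset.prod_congr rfl fun i _ => ?_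
          rw [Int.card_Icc]
          have : ((n i : ℤ) + 1 - -(n i : ℤ)).toNat = 2 * n i + 1 := by omega
          rw [this]; push_cast; ring
      _ ≤ ∏ i, (11 * max 1 ‖Y (u i)‖) :=
          Finset.prod_le_prod (fun i _ => by positivity) fun i _ => by linarith [hn1 i, hm i]
      _ = _ := by rw [Finset.prod_mul_distrib]; simp
  · have hcoef : ∀ i, |u.repr v i| ≤ δ := fun i => by
      rw [u.repr_apply_apply]
      refine (abs_real_inner_le_norm _ _).trans ?_
      rw [u.norm_eq_one, one_mul]; exact hv.le
    let k : Fin 3 → ℤ := fun i => ⌊u.repr v i * n i / δ⌋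
    have hkδ : ∀ i, |u.repr v i - k i * δ / n i| ≤ δ / n i := fun i => by
      have h1 := Int.floor_le (u.repr v i * n i / δ)
      have h2 := Int.lt_floor_add_one (u.repr v i * n i / δ)
      have e1 : u.repr v i - k i * δ / n i = (u.repr v i * n i / δ - k i) * (δ / n i) := by
        have := (hn0 i).ne'
        field_simp
      rw [e1, abs_mul, abs_of_pos (div_pos hδ (hn0 i))]
      refine mul_le_of_le_one_left (div_pos hδ (hn0 i)).le ?_
      rw [abs_le]
      constructor <;> simp only [k] <;> linarith
    refine mem_iUnion₂.2 ⟨q + ∑ i, (k i * δ / n i : ℝ) • Y (u i),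
      Finset.mem_image_of_mem _ (Fintype.mem_piFinset.2 fun i => Finset.mem_Icc.2 ?_), ?_⟩
    · have h1 := abs_le.1 (hcoef i)
      constructor
      · refine Int.le_floor.2 ?_
        rw [le_div_iff₀ hδ]
        push_cast
        nlinarith [hn0 i]
      · refine Int.floor_le_iff.2 ?_
        rw [div_lt_iff₀ hδ]
        push_cast
        nlinarith [hn0 i]
    · have e2 : q + Y v + e - (q + ∑ i, (k i * δ / n i : ℝ) • Y (u i)) =
          ∑ i, (u.repr v i - k i * δ / n i) • Y (u i) + e := by
        have : Y v = ∑ i, u.repr v i • Y (u i) := by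
          conv_lhs => rw [← u.sum_repr v]
          simp
        rw [this]
        simp_rw [sub_smul]
        rw [Finset.sum_sub_distrib]
        abel
      rw [Metric.mem_ball, dist_eq_norm, e2]
      calc _ ≤ ∑ i, ‖(u.repr v i - k i * δ / n i) • Y (u i)‖ + ‖e‖ :=
            (norm_add_le _ _).trans (by gcongr; exact norm_sum_le _ _)
        _ ≤ ∑ i : Fin 3, δ / 4 + δ / 8 := by
            gcongr with i
            rw [norm_smul, Real.norm_eq_abs]
            calc _ ≤ δ / n i * ‖Y (u i)‖ := by gcongr; exact hkδ i
              _ ≤ δ / 4 := by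
                rw [div_mul_eq_mul_div, div_le_iff₀ (hn0 i)]
                nlinarith [hn4 i, le_max_right 1 ‖Y (u i)‖]
        _ < δ := by
            simp; linarith

/-- A linear endomorphism maps some orthonormal basis to an orthogonal family. -/
lemma exists_orthonormalBasis_map_orthogonal [FiniteDimensional ℝ E] {n : ℕ}
    (hn : Module.finrank ℝ E = n) (Y : E →ₗ[ℝ] E) :
    ∃ u : OrthonormalBasis (Fin n) ℝ E, ∀ i j, i ≠ j → inner ℝ (Y (u i)) (Y (u j)) = 0 := by
  have hT : (LinearMap.adjoint Y ∘ₗ Y).IsSymmetric := Y.isSymmetric_adjoint_mul_self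
  refine ⟨hT.eigenvectorBasis hn, fun i j hij => ?_⟩
  rw [← LinearMap.adjoint_inner_right]
  have := hT.apply_eigenvectorBasis hn j
  rw [LinearMap.comp_apply] at this
  rw [this, inner_smul_right, (hT.eigenvectorBasis hn).orthonormal.2 hij, mul_zero]

/-- A bound for all partial products of three real numbers, the empty one included, bounds
the product of their maxima with `1`. -/
lemma prod_max_one_le {s : Fin 3 → ℝ} {B : ℝ} (h : ∀ S : Finset (Fin 3), ∏ i ∈ S, s i ≤ B) :
    ∏ i, max 1 (s i) ≤ B := by
  classical
  refine le_of_eq_of_le ?_ (h (Finset.univ.filter fun i => 1 < s i))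
  rw [Finset.prod_filter]
  refine Finset.prod_congr rfl fun i _ => ?_
  split_ifs with hi
  · exact max_eq_right hi.le
  · exact max_eq_left (not_lt.1 hi)

end Ellipsoid

local notation "E3" => EuclideanSpace ℝ (Fin 3)

/-! ### The linearized Lanford flow -/

section Linearization

/-- The Jacobian of the Lanford field at `p`, as a continuous linear map. -/
noncomputable def lanfordJacobian (a : ℝ) (p : E3) : E3 →L[ℝ] E3 :=
  LinearMap.toContinuousLinearMap
    { toFun := fun v => !₂[(a - 1 + p 2) * v 0 - v 1 + p 0 * v 2,
        v 0 + (a - 1 + p 2) * v 1 + p 1 * v 2,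
        -2 * p 0 * v 0 - 2 * p 1 * v 1 + (a - 2 * p 2) * v 2]
      map_add' := fun v w => by
        ext i; fin_cases i <;> simp <;> ring
      map_smul' := fun c v => by
        ext i; fin_cases i <;> simp <;> ring }

lemma lanfordJacobian_apply (a : ℝ) (p v : E3) :
    lanfordJacobian a p v = !₂[(a - 1 + p 2) * v 0 - v 1 + p 0 * v 2,
        v 0 + (a - 1 + p 2) * v 1 + p 1 * v 2,
        -2 * p 0 * v 0 - 2 * p 1 * v 1 + (a - 2 * p 2) * v 2] := rfl

lemma continuous_lanfordJacobian (a : ℝ) : Continuous (lanfordJacobian a) := by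
  refine continuous_clm_apply.2 fun v => ?_
  simp_rw [lanfordJacobian_apply]
  refine (PiLp.continuous_toLp 2 _).comp (continuous_pi fun i => ?_)
  fin_cases i <;> simp <;> fun_prop

/-- The Lanford field is quadratic, so its first-order Taylor remainder is quadratic in the
increment, with a constant that does not depend on the base point. -/
lemma norm_lanfordField_sub_sub_le (a : ℝ) (p q : E3) :
    ‖lanfordField a q - lanfordField a p - lanfordJacobian a p (q - p)‖ ≤ 2 * ‖q - p‖ ^ 2 := by
  refine abs_le_of_sq_le_sq' ?_ (by positivity) |>.2
  rw [mul_pow, EuclideanSpace.real_norm_sq_eq, EuclideanSpace.real_norm_sq_eq]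
  simp only [lanfordField, lanfordJacobian_apply, Fin.sum_univ_three, PiLp.sub_apply]
  simp
  have e : ((a - 1) * q 0 - q 1 + q 0 * q 2 - ((a - 1) * p 0 - p 1 + p 0 * p 2) -
      ((a - 1 + p 2) * (q 0 - p 0) - (q 1 - p 1) + p 0 * (q 2 - p 2))) =
      (q 0 - p 0) * (q 2 - p 2) := by ring
  have e' : (q 0 + (a - 1) * q 1 + q 1 * q 2 - (p 0 + (a - 1) * p 1 + p 1 * p 2) -
      (q 0 - p 0 + (a - 1 + p 2) * (q 1 - p 1) + p 1 * (q 2 - p 2))) =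
      (q 1 - p 1) * (q 2 - p 2) := by ring
  have e'' : (a * q 2 - (q 0 ^ 2 + q 1 ^ 2 + q 2 ^ 2) - (a * p 2 - (p 0 ^ 2 + p 1 ^ 2 + p 2 ^ 2)) -
      (-(2 * p 0 * (q 0 - p 0)) - 2 * p 1 * (q 1 - p 1) + (a - 2 * p 2) * (q 2 - p 2))) =
      -((q 0 - p 0) ^ 2 + (q 1 - p 1) ^ 2 + (q 2 - p 2) ^ 2) := by ring
  rw [e, e', e'']
  set x := q 0 - p 0
  set y := q 1 - p 1
  set z := q 2 - p 2
  nlinarith [sq_nonneg (x ^ 2), sq_nonneg (y ^ 2), sq_nonneg (z ^ 2), sq_nonneg (x * y),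
    sq_nonneg (x * z), sq_nonneg (y * z)]

/-- Second-order comparison of two trajectories: their difference follows the linearized flow up
to an error quadratic in the initial distance, uniformly over all pairs of trajectories in a
bounded region. -/
lemma exists_norm_sub_sub_le_mul_sq (a : ℝ) {K : Set E3} (hK : IsCompact K) {τ : ℝ}
    (hτ : 0 ≤ τ) :
    ∃ C : ℝ, 0 < C ∧ ∀ γ η y : ℝ → E3,
      IsIntegralCurveOn γ (fun _ => lanfordField a) (Icc 0 τ) →
      IsIntegralCurveOn η (fun _ => lanfordField a) (Icc 0 τ) →
      (∀ t ∈ Icc 0 τ, γ t ∈ K) → (∀ t ∈ Icc 0 τ, η t ∈ K) → y 0 = η 0 - γ 0 →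
      (∀ t ∈ Icc 0 τ, HasDerivWithinAt y (lanfordJacobian a (γ t) (y t)) (Icc 0 τ) t) →
      ‖η τ - γ τ - y τ‖ ≤ C * ‖η 0 - γ 0‖ ^ 2 := by
  obtain ⟨L₀, hL₀⟩ := hK.exists_bound_of_continuousOn (continuous_lanfordJacobian a).continuousOn
  obtain ⟨R₀, hR₀⟩ := hK.exists_bound_of_continuousOn (f := fun x : E3 => x) continuousOn_id
  set L := max L₀ 1 with hL
  set R := max R₀ 0 with hR
  have hL1 : 1 ≤ L := le_max_right _ _
  have hR0 : 0 ≤ R := le_max_right _ _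
  have hLK : ∀ x ∈ K, ‖lanfordJacobian a x‖ ≤ L := fun x hx => (hL₀ x hx).trans (le_max_left _ _)
  have hRK : ∀ x ∈ K, ‖x‖ ≤ R := fun x hx => (hR₀ x hx).trans (le_max_left _ _)
  -- `M` is a Lipschitz constant of the field on `K`
  set M := L + 2 * (2 * R) with hM
  refine ⟨2 * Real.exp (M * τ) ^ 2 / L * Real.exp (L * τ), by positivity,
    fun γ η y hγ hη hγK hηK hy0 hy => ?_⟩
  set d := ‖η 0 - γ 0‖ with hd
  have hIci : ∀ {t : ℝ}, t ∈ Ico 0 τ → Icc 0 τ ∈ 𝓝[≥] t := fun ht =>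
    Icc_mem_nhdsGE_of_mem ht
  have hΔ : ∀ t ∈ Icc 0 τ, ‖η t - γ t‖ ≤ d * Real.exp (M * τ) := by
    intro t ht
    have h := norm_le_gronwallBound_of_norm_deriv_right_le (f := fun t => η t - γ t)
      (f' := fun t => lanfordField a (η t) - lanfordField a (γ t)) (δ := d) (K := M) (ε := 0)
      (a := 0) (b := τ) (hη.continuousOn.sub hγ.continuousOn)
      (fun t ht => ((hη t (Ico_subset_Icc_self ht)).fun_sub
        (hγ t (Ico_subset_Icc_self ht))).mono_of_mem_nhdsWithin (hIci ht)) le_rfl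
      (fun t ht => by
        have ht' := Ico_subset_Icc_self ht
        have h1 := norm_lanfordField_sub_sub_le a (γ t) (η t)
        have h2 := (lanfordJacobian a (γ t)).le_of_opNorm_le (hLK _ (hγK t ht')) (η t - γ t)
        have h3 : ‖η t - γ t‖ ≤ 2 * R := by
          linarith [norm_sub_le (η t) (γ t), hRK _ (hγK t ht'), hRK _ (hηK t ht')]
        have h4 := norm_le_norm_sub_add (lanfordField a (η t) - lanfordField a (γ t))
          (lanfordJacobian a (γ t) (η t - γ t))
        nlinarith [norm_nonneg (η t - γ t)]) t ht
    rw [gronwallBound_ε0, sub_zero] at h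
    refine h.trans ?_
    gcongr
    exact ht.2
  have h := norm_le_gronwallBound_of_norm_deriv_right_le (f := fun t => η t - γ t - y t)
    (f' := fun t => lanfordField a (η t) - lanfordField a (γ t) - lanfordJacobian a (γ t) (y t))
    (δ := 0) (K := L) (ε := 2 * (d * Real.exp (M * τ)) ^ 2) (a := 0) (b := τ)
    ((hη.continuousOn.sub hγ.continuousOn).sub fun t ht => (hy t ht).continuousWithinAt)
    (fun t ht => (((hη t (Ico_subset_Icc_self ht)).fun_sub
      (hγ t (Ico_subset_Icc_self ht))).fun_sub
        (hy t (Ico_subset_Icc_self ht))).mono_of_mem_nhdsWithin (hIci ht))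
    (by simp [hy0])
    (fun t ht => by
      have ht' := Ico_subset_Icc_self ht
      have h1 := norm_lanfordField_sub_sub_le a (γ t) (η t)
      have h2 := (lanfordJacobian a (γ t)).le_of_opNorm_le (hLK _ (hγK t ht')) (η t - γ t - y t)
      have h3 : ‖η t - γ t‖ ^ 2 ≤ (d * Real.exp (M * τ)) ^ 2 :=
        pow_le_pow_left₀ (norm_nonneg _) (hΔ t ht') 2
      have e : lanfordField a (η t) - lanfordField a (γ t) - lanfordJacobian a (γ t) (y t) =
          lanfordJacobian a (γ t) (η t - γ t - y t) + (lanfordField a (η t) -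
            lanfordField a (γ t) - lanfordJacobian a (γ t) (η t - γ t)) := by
        rw [map_sub _ (η t - γ t)]; abel
      rw [e]
      linarith [norm_add_le (lanfordJacobian a (γ t) (η t - γ t - y t)) (lanfordField a (η t) -
            lanfordField a (γ t) - lanfordJacobian a (γ t) (η t - γ t))])
    τ (right_mem_Icc.2 hτ)
  rw [gronwallBound_of_K_ne_0 (by positivity)] at h
  refine h.trans ?_
  simp only [zero_mul, zero_add, sub_zero]
  calc 2 * (d * Real.exp (M * τ)) ^ 2 / L * (Real.exp (L * τ) - 1)
      ≤ 2 * (d * Real.exp (M * τ)) ^ 2 / L * Real.exp (L * τ) := by gcongr; linarith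
    _ = _ := by ring

end Linearization

/-! ### Growth of lengths, areas and volumes -/

section Growth

/-- The infinitesimal inequalities behind the entropy bound.  With respect to the constant metric
`dx² + dy² + dz² / 2` the symmetrized Jacobian is diagonal, with entries `a - 1 + z` (twice) and
`a - 2 * z`.  Twice any sum of distinct entries is at most `8 * a - 4` minus the derivative of
`(4 / a) * z` along the flow. -/
lemma lanford_rate_bounds {a : ℝ} (ha : 2 / 3 ≤ a) (p : E3) :
    2 * (a - 1 + p 2) ≤ 8 * a - 4 - 4 / a * lanfordField a p 2 ∧
    2 * (a - 2 * p 2) ≤ 8 * a - 4 - 4 / a * lanfordField a p 2 ∧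
    4 * (a - 1 + p 2) ≤ 8 * a - 4 - 4 / a * lanfordField a p 2 ∧
    2 * (2 * a - 1 - p 2) ≤ 8 * a - 4 - 4 / a * lanfordField a p 2 ∧
    2 * (3 * a - 2) ≤ 8 * a - 4 - 4 / a * lanfordField a p 2 := by
  have ha0 : 0 < a := by linarith
  have hw : p 2 ^ 2 / a * a = p 2 ^ 2 := div_mul_cancel₀ _ ha0.ne'
  set w := p 2 ^ 2 / a with hwdef
  have hle : 4 / a * lanfordField a p 2 ≤ 4 * p 2 - 4 * w := by
    have e : 4 / a * lanfordField a p 2 = 4 * p 2 - 4 * w - 4 / a * (p 0 ^ 2 + p 1 ^ 2) := by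
      simp [lanfordField, hwdef]
      field_simp
      ring
    have : 0 ≤ 4 / a * (p 0 ^ 2 + p 1 ^ 2) := by positivity
    linarith
  -- the weighted square `(p 2 - c * a) ^ 2 / a`
  have hsq : ∀ c : ℝ, 0 ≤ w - 2 * c * p 2 + c ^ 2 * a := fun c => by
    have e : w - 2 * c * p 2 + c ^ 2 * a = (p 2 - c * a) ^ 2 / a := by
      rw [hwdef]; field_simp; ring
    rw [e]; positivity
  refine ⟨?_, ?_, ?_, ?_, ?_⟩
  · linarith [hsq (3 / 4)]
  · linarith [hsq 0]
  · linarith [hsq 1]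
  · linarith [hsq (1 / 4)]
  · linarith [hsq (1 / 2)]

variable {a τ V : ℝ} {γ : ℝ → E3}

lemma HasDerivWithinAt.euclidean_apply {y : ℝ → E3} {y' : E3} {s : Set ℝ} {t : ℝ}
    (h : HasDerivWithinAt y y' s t) (i : Fin 3) : HasDerivWithinAt (fun t => y t i) (y' i) s t :=
  (EuclideanSpace.proj (𝕜 := ℝ) i).hasFDerivAt.comp_hasDerivWithinAt t h

/-- Grönwall's inequality with the weight `(4 / a) * z` along a trajectory. -/
lemma le_mul_exp_of_lanford_rate (hτ : 0 ≤ τ)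
    (hγ : IsIntegralCurveOn γ (fun _ => lanfordField a) (Icc 0 τ))
    (hV : 4 / a * γ 0 2 - 4 / a * γ τ 2 ≤ V) {g g' : ℝ → ℝ} (hg0 : 0 ≤ g 0)
    (hg : ∀ t ∈ Icc 0 τ, HasDerivWithinAt g (g' t) (Icc 0 τ) t)
    (hle : ∀ t ∈ Icc 0 τ, g' t ≤ (8 * a - 4 - 4 / a * lanfordField a (γ t) 2) * g t) :
    g τ ≤ g 0 * Real.exp ((8 * a - 4) * τ + V) :=
  (le_mul_exp_of_hasDerivWithinAt_le hτ hg
    (fun t ht => ((hγ t ht).euclidean_apply 2).const_mul (4 / a)) hle).trans (by gcongr)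

/-- Growth of lengths under the linearized flow. -/
lemma lanford_length_growth (ha : 2 / 3 ≤ a) (hτ : 0 ≤ τ)
    (hγ : IsIntegralCurveOn γ (fun _ => lanfordField a) (Icc 0 τ))
    (hV : 4 / a * γ 0 2 - 4 / a * γ τ 2 ≤ V) {y : ℝ → E3}
    (hy : ∀ t ∈ Icc 0 τ, HasDerivWithinAt y (lanfordJacobian a (γ t) (y t)) (Icc 0 τ) t) :
    ‖y τ‖ ^ 2 ≤ 2 * ‖y 0‖ ^ 2 * Real.exp ((8 * a - 4) * τ + V) := by
  have h := le_mul_exp_of_lanford_rate hτ hγ hV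
    (g := fun t => y t 0 ^ 2 + y t 1 ^ 2 + y t 2 ^ 2 / 2)
    (g' := fun t => 2 * (a - 1 + γ t 2) * (y t 0 ^ 2 + y t 1 ^ 2) +
      2 * (a - 2 * γ t 2) * (y t 2 ^ 2 / 2)) (by positivity) (fun t ht => by
      have h0 := (hy t ht).euclidean_apply 0
      have h1 := (hy t ht).euclidean_apply 1
      have h2 := (hy t ht).euclidean_apply 2
      refine (((h0.fun_pow 2).fun_add (h1.fun_pow 2)).fun_add
        ((h2.fun_pow 2).div_const 2)).congr_deriv ?_
      simp [lanfordJacobian_apply]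
      ring) (fun t ht => by
      obtain ⟨h1, h2, -⟩ := lanford_rate_bounds ha (γ t)
      have := mul_le_mul_of_nonneg_right h1 (show 0 ≤ y t 0 ^ 2 + y t 1 ^ 2 by positivity)
      have := mul_le_mul_of_nonneg_right h2 (show 0 ≤ y t 2 ^ 2 / 2 by positivity)
      linarith)
  simp only [EuclideanSpace.real_norm_sq_eq, Fin.sum_univ_three]
  have hE := Real.exp_pos ((8 * a - 4) * τ + V)
  nlinarith [mul_nonneg hE.le (sq_nonneg (y 0 2)), sq_nonneg (y τ 0), sq_nonneg (y τ 1)]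

/-- Growth of areas under the linearized flow, for two vectors that are orthonormal at time `0`
and orthogonal at time `τ`.  The cross product `w` of two solutions solves
`ẇ = (tr J - Jᵀ) w`, whose symmetric part is diagonal for the dual metric `w₀² + w₁² + 2 w₂²`. -/
lemma lanford_area_growth (ha : 2 / 3 ≤ a) (hτ : 0 ≤ τ)
    (hγ : IsIntegralCurveOn γ (fun _ => lanfordField a) (Icc 0 τ))
    (hV : 4 / a * γ 0 2 - 4 / a * γ τ 2 ≤ V) {y z : ℝ → E3}
    (hy : ∀ t ∈ Icc 0 τ, HasDerivWithinAt y (lanfordJacobian a (γ t) (y t)) (Icc 0 τ) t)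
    (hz : ∀ t ∈ Icc 0 τ, HasDerivWithinAt z (lanfordJacobian a (γ t) (z t)) (Icc 0 τ) t)
    (hy0 : ‖y 0‖ = 1) (hz0 : ‖z 0‖ = 1) (hyz : inner ℝ (y τ) (z τ) = 0) :
    (‖y τ‖ * ‖z τ‖) ^ 2 ≤ 2 * Real.exp ((8 * a - 4) * τ + V) := by
  set w0 : ℝ → ℝ := fun t => y t 1 * z t 2 - y t 2 * z t 1 with hw0
  set w1 : ℝ → ℝ := fun t => y t 2 * z t 0 - y t 0 * z t 2 with hw1
  set w2 : ℝ → ℝ := fun t => y t 0 * z t 1 - y t 1 * z t 0 with hw2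
  have hlag : ∀ t, w0 t ^ 2 + w1 t ^ 2 + w2 t ^ 2 =
      ‖y t‖ ^ 2 * ‖z t‖ ^ 2 - inner ℝ (y t) (z t) ^ 2 := fun t => by
    simp only [EuclideanSpace.real_norm_sq_eq, PiLp.inner_apply, Fin.sum_univ_three, hw0, hw1, hw2]
    simp
    ring
  have h := le_mul_exp_of_lanford_rate hτ hγ hV
    (g := fun t => w0 t ^ 2 + w1 t ^ 2 + 2 * w2 t ^ 2)
    (g' := fun t => 2 * (2 * a - 1 - γ t 2) * (w0 t ^ 2 + w1 t ^ 2) +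
      4 * (a - 1 + γ t 2) * (2 * w2 t ^ 2)) (by positivity) (fun t ht => by
      have h0 := (hy t ht).euclidean_apply 0
      have h1 := (hy t ht).euclidean_apply 1
      have h2 := (hy t ht).euclidean_apply 2
      have k0 := (hz t ht).euclidean_apply 0
      have k1 := (hz t ht).euclidean_apply 1
      have k2 := (hz t ht).euclidean_apply 2
      have d0 := (h1.fun_mul k2).fun_sub (h2.fun_mul k1)
      have d1 := (h2.fun_mul k0).fun_sub (h0.fun_mul k2)
      have d2 := (h0.fun_mul k1).fun_sub (h1.fun_mul k0)
      refine (((d0.fun_pow 2).fun_add (d1.fun_pow 2)).fun_add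
        ((d2.fun_pow 2).const_mul 2)).congr_deriv ?_
      simp [lanfordJacobian_apply, hw0, hw1, hw2]
      ring) (fun t ht => by
      obtain ⟨-, -, h1, h2, -⟩ := lanford_rate_bounds ha (γ t)
      have := mul_le_mul_of_nonneg_right h2 (show 0 ≤ w0 t ^ 2 + w1 t ^ 2 by positivity)
      have := mul_le_mul_of_nonneg_right h1 (show 0 ≤ 2 * w2 t ^ 2 by positivity)
      linarith)
  have l0 := hlag 0
  have lτ := hlag τ
  rw [hy0, hz0] at l0
  rw [hyz] at lτ
  have hE := Real.exp_pos ((8 * a - 4) * τ + V)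
  have hg0 : w0 0 ^ 2 + w1 0 ^ 2 + 2 * w2 0 ^ 2 ≤ 2 := by
    nlinarith [sq_nonneg (inner ℝ (y 0) (z 0)), sq_nonneg (w0 0), sq_nonneg (w1 0)]
  calc (‖y τ‖ * ‖z τ‖) ^ 2 = w0 τ ^ 2 + w1 τ ^ 2 + w2 τ ^ 2 := by rw [lτ]; ring
    _ ≤ w0 τ ^ 2 + w1 τ ^ 2 + 2 * w2 τ ^ 2 := by linarith [sq_nonneg (w2 τ)]
    _ ≤ _ := h.trans (by gcongr)

/-- Growth of volumes under the linearized flow, for an orthonormal frame whose image at time `τ`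
is orthogonal.  The determinant grows at the constant rate `tr J = 3 * a - 2`. -/
lemma lanford_volume_growth (ha : 2 / 3 ≤ a) (hτ : 0 ≤ τ)
    (hγ : IsIntegralCurveOn γ (fun _ => lanfordField a) (Icc 0 τ))
    (hV : 4 / a * γ 0 2 - 4 / a * γ τ 2 ≤ V) {x y z : ℝ → E3}
    (hx : ∀ t ∈ Icc 0 τ, HasDerivWithinAt x (lanfordJacobian a (γ t) (x t)) (Icc 0 τ) t)
    (hy : ∀ t ∈ Icc 0 τ, HasDerivWithinAt y (lanfordJacobian a (γ t) (y t)) (Icc 0 τ) t)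
    (hz : ∀ t ∈ Icc 0 τ, HasDerivWithinAt z (lanfordJacobian a (γ t) (z t)) (Icc 0 τ) t)
    (hx0 : ‖x 0‖ = 1) (hy0 : ‖y 0‖ = 1) (hz0 : ‖z 0‖ = 1)
    (hxy0 : inner ℝ (x 0) (y 0) = 0) (hxz0 : inner ℝ (x 0) (z 0) = 0)
    (hyz0 : inner ℝ (y 0) (z 0) = 0) (hxy : inner ℝ (x τ) (y τ) = 0)
    (hxz : inner ℝ (x τ) (z τ) = 0) (hyz : inner ℝ (y τ) (z τ) = 0) :
    (‖x τ‖ * ‖y τ‖ * ‖z τ‖) ^ 2 ≤ Real.exp ((8 * a - 4) * τ + V) := by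
  set D : ℝ → ℝ := fun t => x t 0 * (y t 1 * z t 2 - y t 2 * z t 1) +
    x t 1 * (y t 2 * z t 0 - y t 0 * z t 2) + x t 2 * (y t 0 * z t 1 - y t 1 * z t 0) with hD
  -- the Gram determinant
  have hgram : ∀ t, D t ^ 2 = ‖x t‖ ^ 2 * ‖y t‖ ^ 2 * ‖z t‖ ^ 2 +
      2 * inner ℝ (x t) (y t) * inner ℝ (y t) (z t) * inner ℝ (x t) (z t) -
      ‖x t‖ ^ 2 * inner ℝ (y t) (z t) ^ 2 - ‖y t‖ ^ 2 * inner ℝ (x t) (z t) ^ 2 -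
      ‖z t‖ ^ 2 * inner ℝ (x t) (y t) ^ 2 := fun t => by
    simp only [EuclideanSpace.real_norm_sq_eq, PiLp.inner_apply, Fin.sum_univ_three, hD]
    simp
    ring
  have h := le_mul_exp_of_lanford_rate hτ hγ hV (g := fun t => D t ^ 2)
    (g' := fun t => 2 * (3 * a - 2) * D t ^ 2) (by positivity) (fun t ht => by
      have g0 := (hx t ht).euclidean_apply 0
      have g1 := (hx t ht).euclidean_apply 1
      have g2 := (hx t ht).euclidean_apply 2
      have h0 := (hy t ht).euclidean_apply 0
      have h1 := (hy t ht).euclidean_apply 1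
      have h2 := (hy t ht).euclidean_apply 2
      have k0 := (hz t ht).euclidean_apply 0
      have k1 := (hz t ht).euclidean_apply 1
      have k2 := (hz t ht).euclidean_apply 2
      have d0 := (h1.fun_mul k2).fun_sub (h2.fun_mul k1)
      have d1 := (h2.fun_mul k0).fun_sub (h0.fun_mul k2)
      have d2 := (h0.fun_mul k1).fun_sub (h1.fun_mul k0)
      have dD : HasDerivWithinAt D ((3 * a - 2) * D t) (Icc 0 τ) t := by
        refine (((g0.fun_mul d0).fun_add (g1.fun_mul d1)).fun_add
          (g2.fun_mul d2)).congr_deriv ?_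
        simp [lanfordJacobian_apply, hD]
        ring
      refine (dD.fun_pow 2).congr_deriv ?_
      simp
      ring) (fun t ht => mul_le_mul_of_nonneg_right (lanford_rate_bounds ha (γ t)).2.2.2.2
        (sq_nonneg _))
  simp only [hgram, hxy, hxz, hyz, hxy0, hxz0, hyz0, hx0, hy0, hz0] at h
  calc _ = _ := by ring
    _ ≤ _ := h
    _ = _ := by ring

end Growth

/-! ### The entropy bound for the Lanford system -/

section Main

/-- The images of a suitable orthonormal basis under the linearized flow have partial products of
lengths bounded by `2 * exp ((4 * a - 2) * τ + V / 2)`; these lengths are the singular values of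
the linearized flow. -/
lemma prod_norm_lanford_solution_le {a τ V : ℝ} {γ : ℝ → E3} (ha : 2 / 3 ≤ a) (hτ : 0 ≤ τ)
    (hγ : IsIntegralCurveOn γ (fun _ => lanfordField a) (Icc 0 τ))
    (hV : 4 / a * γ 0 2 - 4 / a * γ τ 2 ≤ V) (hV0 : 0 ≤ V) {Y : E3 →ₗ[ℝ] E3}
    (hY : ∀ u, ∃ y : ℝ → E3, y 0 = u ∧ y τ = Y u ∧
      ∀ t ∈ Icc 0 τ, HasDerivWithinAt y (lanfordJacobian a (γ t) (y t)) (Icc 0 τ) t)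
    (u : OrthonormalBasis (Fin 3) ℝ E3) (hu : ∀ i j, i ≠ j → inner ℝ (Y (u i)) (Y (u j)) = 0)
    (S : Finset (Fin 3)) :
    ∏ i ∈ S, ‖Y (u i)‖ ≤ 2 * Real.exp ((4 * a - 2) * τ + V / 2) := by
  choose y hy0 hyτ hy using fun i => hY (u i)
  have hn : ∀ i, ‖y i 0‖ = 1 := fun i => by rw [hy0, u.norm_eq_one]
  have ho : ∀ i j, i ≠ j → inner ℝ (y i 0) (y j 0) = 0 := fun i j hij => by
    rw [hy0, hy0]; exact u.orthonormal.2 hij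
  have hoτ : ∀ i j, i ≠ j → inner ℝ (y i τ) (y j τ) = 0 := fun i j hij => by
    rw [hyτ, hyτ]; exact hu i j hij
  simp_rw [← hyτ]
  set X := Real.exp ((4 * a - 2) * τ + V / 2) with hX
  have hXX : Real.exp ((8 * a - 4) * τ + V) = X ^ 2 := by
    rw [hX, ← Real.exp_nat_mul]; congr 1; push_cast; ring
  have hX1 : 1 ≤ X := Real.one_le_exp (add_nonneg (mul_nonneg (by linarith) hτ) (by linarith))
  have key : (∏ i ∈ S, ‖y i τ‖) ^ 2 ≤ 2 * X ^ 2 := by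
    have hcard : S.card ≤ 3 := by simpa using S.card_le_univ
    interval_cases hc : S.card
    · rw [Finset.card_eq_zero.1 hc, Finset.prod_empty]
      nlinarith
    · obtain ⟨i, rfl⟩ := Finset.card_eq_one.1 hc
      have := lanford_length_growth ha hτ hγ hV (hy i)
      rw [hn, hXX] at this
      simpa using this
    · obtain ⟨i, j, hij, rfl⟩ := Finset.card_eq_two.1 hc
      have := lanford_area_growth ha hτ hγ hV (hy i) (hy j) (hn i) (hn j) (hoτ i j hij)
      rw [hXX] at this
      rwa [Finset.prod_pair hij]
    · rw [(Finset.card_eq_iff_eq_univ S).1 (by simpa using hc), Fin.prod_univ_three]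
      have := lanford_volume_growth ha hτ hγ hV (hy 0) (hy 1) (hy 2) (hn 0) (hn 1) (hn 2)
        (ho 0 1 (by decide)) (ho 0 2 (by decide)) (ho 1 2 (by decide))
        (hoτ 0 1 (by decide)) (hoτ 0 2 (by decide)) (hoτ 1 2 (by decide))
      rw [hXX] at this
      nlinarith
  refine (abs_le_of_sq_le_sq' (key.trans ?_) (by positivity)).2
  nlinarith

/-- Time-`τ` images of small balls are covered by `O(exp ((4 * a - 2) * τ))` balls of the same
radius, with an implied constant depending only on `a` and `K`. -/
lemma exists_hasFlowCovers_lanford {a : ℝ} (ha : 2 / 3 ≤ a) {K : Set E3} (hK : IsCompact K)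
    (hinv : IsForwardInvariantSet (lanfordField a) K) :
    ∃ B : ℝ, 0 < B ∧ ∀ τ, 0 ≤ τ → ∀ᶠ δ in 𝓝[>] (0 : ℝ),
      HasFlowCovers (lanfordField a) K δ τ (B * Real.exp ((4 * a - 2) * τ)) := by
  have ha0 : 0 < a := by linarith
  obtain ⟨V, hV⟩ := hK.exists_bound_of_continuousOn (f := fun x : E3 => 4 / a * x 2)
    (by fun_prop)
  obtain ⟨M, hM⟩ := hK.exists_bound_of_continuousOn (continuous_lanfordJacobian a).continuousOn
  refine ⟨11 ^ 3 * (2 * Real.exp (2 * max V 0 / 2)), by positivity, fun τ hτ => ?_⟩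
  obtain ⟨C, hC, hCerr⟩ := exists_norm_sub_sub_le_mul_sq a hK hτ
  -- for `δ < 1 / (8 * C)` the quadratic error `C * δ ^ 2` is below `δ / 8`
  have hsmall : ∀ᶠ δ in 𝓝[>] (0 : ℝ), δ < 1 / (8 * C) :=
    mem_nhdsWithin_of_mem_nhds (Iio_mem_nhds (by positivity))
  filter_upwards [hsmall, self_mem_nhdsWithin] with δ hδC hδ p hp
  replace hδ : 0 < δ := hδ
  obtain ⟨γ, hγ, rfl⟩ := hinv.1 p hp
  replace hγ : IsIntegralCurveOn γ (fun _ => lanfordField a) (Icc 0 τ) :=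
    hγ.mono Icc_subset_Ici_self
  have hγK : ∀ t ∈ Icc 0 τ, γ t ∈ K := fun t ht => hinv.mem hγ hp ht
  obtain ⟨Y, hY⟩ := exists_fundamental_solution (A := fun t => lanfordJacobian a (γ t)) hτ
    ((continuous_lanfordJacobian a).comp_continuousOn hγ.continuousOn)
    (fun t ht => hM _ (hγK t ht))
  obtain ⟨u, hu⟩ := exists_orthonormalBasis_map_orthogonal (n := 3) (by simp) Y
  obtain ⟨G, hG, hGcov⟩ := exists_cover_ellipsoid u Y (γ τ) hδ
  refine ⟨G, hG.trans ?_, ?_⟩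
  · have hV' : 4 / a * γ 0 2 - 4 / a * γ τ 2 ≤ 2 * max V 0 := by
      have h1 := (abs_le.1 (hV _ hp)).2
      have h2 := (abs_le.1 (hV _ (hγK τ (right_mem_Icc.2 hτ)))).1
      linarith [le_max_left V 0]
    have := prod_max_one_le (prod_norm_lanford_solution_le ha hτ hγ hV' (by positivity) hY u hu)
    rw [Real.exp_add] at this
    linarith
  · rintro _ ⟨η, hη, ⟨hη0, hη0K⟩, rfl⟩
    have hd : ‖η 0 - γ 0‖ < δ := by rwa [← dist_eq_norm]
    obtain ⟨y, hy0, hyτ, hy⟩ := hY (η 0 - γ 0)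
    have herr := hCerr γ η y hγ hη hγK (fun t ht => hinv.mem hη hη0K ht) hy0 hy
    have hmem := hGcov (η 0 - γ 0) (η τ - γ τ - y τ) hd (by
      refine herr.trans ?_
      have h1 : ‖η 0 - γ 0‖ ^ 2 ≤ δ ^ 2 := pow_le_pow_left₀ (norm_nonneg _) hd.le 2
      rw [lt_div_iff₀ (by positivity)] at hδC
      nlinarith)
    rw [hyτ] at hmem
    convert hmem using 1
    abel

theorem mainTheorem5 (a : ℝ) (ha : 2 / 3 ≤ a) (K : Set (EuclideanSpace ℝ (Fin 3)))
    (hK : IsCompact K) (hinv : IsForwardInvariantSet (lanfordField a) K) :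
    Tendsto (fun τ : ℝ => restorationBits (lanfordField a) K τ / (τ : EReal)) atTop
        (𝓝 (restorationEntropy (lanfordField a) K)) ∧
      restorationEntropy (lanfordField a) K ≤ ((2 * (2 * a - 1) / Real.log 2 : ℝ) : EReal) := by
  obtain ⟨B, hB, hcov⟩ := exists_hasFlowCovers_lanford ha hK hinv
  refine tendsto_restorationEntropy_and_le hinv (B := Real.logb 2 B) fun τ hτ => ?_
  have hl : Real.log 2 ≠ 0 := (Real.log_pos (by norm_num)).ne'
  have e : (2 : ℝ) ^ (2 * (2 * a - 1) / Real.log 2 * τ + Real.logb 2 B) =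
      B * Real.exp ((4 * a - 2) * τ) := by
    rw [Real.rpow_add (by norm_num), Real.rpow_logb (by norm_num) (by norm_num) hB, mul_comm,
      Real.rpow_def_of_pos (by norm_num)]
    congr 2
    field_simp
    ring
  rw [e]
  exact hcov τ hτ

end Main
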